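/- **Data.** Let $\mathcal M=(S,A,p_S,(s_0,l_0),\Pi,L,p_L)$ be a finite labeled MDP: $S$, $A$, $\Pi$ are finite, every $s\in S$ has a nonempty set $A(s)\subseteq A$ of available actions, $p_S(s,a,\cdot)$ is a probability distribution on $S$ for $a\in A(s)$, $L(s)\subseteq 2^\Pi$ is the set of labels that can be observed at $s$, $p_L(s,\cdot)\ge 0$ with $\sum_{l\in L(s)}p_L(s,l)=1$, and $l_0\in L(s_0)$, $p_L(s_0,l_0)>0$. Let $\mathcal A=(Q,2^\Pi,\delta,q_0,F)$, $F=\{F_1,\dots,F_f\}$ with $f\ge 1$, be a limit-deterministic generalized Büchi automaton with finite $Q$: $\delta:Q\times(2^\Pi\cup\{\epsilon\})\to 2^Q$, and there is $Q_D\subseteq Q$ such that from every $q\in Q_D$ each letter of $2^\Pi$ leads to exactly one state, which is in $Q_D$, there is no $\epsilon$-transition from $Q_D$, all $\epsilon$-transitions lead into $Q_D$, and $F_i\subseteq Q_D$ for all $i$. **Embedded automaton.** A tracking frontier $T\subseteq F$ is initially $F$. A transition $q\to q'$ with $q'\in\delta(q,\iota)$, $\iota\in 2^\Pi\cup\{\epsilon\}$,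 is allowed with frontier $T$, written $q'\in\bar\delta(q,T,\iota)$, if $q'$ lies in no $F_j$, or $q'$ lies in some $F_j\in T$, or $T=\emptyset$. The frontier then becomes $f_V(q',T)$: if $q'$ lies in a member of $T$, all sets containing $q'$ are removed from $T$; if $T=\emptyset$ and $q'$ lies in some $F_j$, it is $F$ without the sets containing $q'$; otherwise it is $T$. **Relaxed product MDP $\mathcal R$.** Its states are $x=(s,l,q,T)$ with $l\in L(s)$ and $p_L(s,l)>0$; the initial state is $x_0=(s_0,l_0,q_0,F)$. An action available at $x$ is $u=(a,\iota,q')$ with $a\in A(s)$, $\iota\in 2^\Pi\cup\{\epsilon\}$ and $q'\in\bar\delta(q,T,\iota)$ (so $u$ is just $(a,\iota)$ where the automaton has a single successor). Under $u$ the state becomes $(s',l',q',f_V(q',T))$ with probability $p_S(s,a,s')\,p_L(s',l')$ if $\iota\ne\epsilon$, and $(s,l,q',f_V(q',T))$ with probability $1$ if $\iota=\epsilon$. A run ends in a state without available actions. Let $F_i^{\mathcal R}$ be the set of states with $q\in F_i$. The violation cost $c_V(x,u,x')$ is $0$ if $\iota=\epsilon$; otherwise it is the smallest $\ell^1$ (Hamming)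 distance between the label $l$ of $x$ and a label $l^\ast$ with $q'\in\delta(q,l^\ast)$. An infinite run of $\mathcal R$ is accepted if, for each $i=1,\dots,f$, some state of $F_i^{\mathcal R}$ occurs in it infinitely often. **Rewards and policies.** For $r_\Lambda>0$ let $\Lambda(x)=r_\Lambda$ if $x\in\bigcup_iF_i^{\mathcal R}$ and $\Lambda(x)=0$ otherwise. A stationary policy $\pi$ chooses, at each state that has an available action, an available action, possibly at random. Let $P_\pi$ be its transition matrix (with a zero row at a state without available actions), $V_\pi$ the matrix of the violation rewards $-c_V$ weighted with the transition probabilities, and, for $\beta>0$ and $0<\gamma<1$, $$U_\pi=\sum_{n\ge 0}\gamma^nP_\pi^n\,(\Lambda+\beta V_\pi\mathbf 1).$$ Given a class $\mathcal C$ of stationary policies, $\pi^\ast\in\mathcal C$ is optimal in $\mathcal C$ if $U_\pi(x)\le U_{\pi^\ast}(x)$ for all $\pi\in\mathcal C$ and all states $x$. A stationary policy satisfies the acceptance condition of $\mathcal R$ if almost every run that it induces from $x_0$ is infinite and accepted. **Theorem.** Suppose that some policy $\bar\pi$ (possibly randomized and depending on the past states) induces from $x_0$ a run, all of whose transitions have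 positive probability, that is accepted. Then there are $\kappa>0$ and $\gamma_0\in(0,1)$, depending only on $\mathcal R$, such that for all $r_\Lambda>0$, all $0<\beta\le\kappa r_\Lambda$, all $\gamma\in(\gamma_0,1)$ and every class $\mathcal C$ of stationary policies that contains all deterministic ones (for instance all deterministic, or all randomized stationary policies), there is an optimal policy in $\mathcal C$, and every optimal policy in $\mathcal C$ satisfies the acceptance condition of $\mathcal R$. -/

import Mathlib

open Set Filter MeasureTheory ProbabilityTheory

/-- A labeled finite MDP. `avail s` is the action set `A(s)`, `L s` the set of labels that may be
observed at `s`, and `pL s l` the probability of observing the label `l` at `s`. -/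
structure LabeledMDP (S Act AP : Type*) [Fintype S] where
  avail : S → Finset Act
  avail_nonempty : ∀ s, (avail s).Nonempty
  pS : S → Act → S → ℝ
  pS_nonneg : ∀ s a s', 0 ≤ pS s a s'
  pS_sum : ∀ s, ∀ a ∈ avail s, ∑ s', pS s a s' = 1
  L : S → Finset (Finset AP)
  pL : S → Finset AP → ℝ
  pL_nonneg : ∀ s l, 0 ≤ pL s l
  pL_sum : ∀ s, ∑ l ∈ L s, pL s l = 1
  s₀ : S
  l₀ : Finset AP
  l₀_mem : l₀ ∈ L s₀
  l₀_pos : 0 < pL s₀ l₀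

/-- A limit-deterministic generalized Büchi automaton over the alphabet `2^AP` with accepting sets
`F 0, …, F (f - 1)`. The input symbol `none` is `ε`; the nondeterministic part `Q_N` is the
complement of `QD`. -/
structure LDGBA (AP Q : Type*) (f : ℕ) where
  δ : Q → Option (Finset AP) → Set Q
  q₀ : Q
  F : Fin f → Set Q
  QD : Set Q
  det : ∀ q ∈ QD, ∀ α : Finset AP, ∃ q' ∈ QD, δ q (some α) = {q'}
  eps_QD : ∀ q ∈ QD, δ q none = ∅
  eps_target : ∀ q, δ q none ⊆ QD
  acc : ∀ i, F i ⊆ QD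

noncomputable section

namespace LDGBA

variable {AP Q : Type*} {f : ℕ}

open scoped Classical in
/-- The (indices of the) accepting sets that contain `q`. -/
def hits (A : LDGBA AP Q f) (q : Q) : Finset (Fin f) :=
  Finset.univ.filter fun j => q ∈ A.F j

open scoped Classical in
/-- The tracking-frontier update `f_V(q, T)`: visited sets are removed from `T`; when `T` is empty,
a round has been completed and `T` counts as the whole family of accepting sets. -/
def frontier (A : LDGBA AP Q f) (q : Q) (T : Finset (Fin f)) : Finset (Fin f) :=
  if (A.hits q ∩ T).Nonempty then T \ A.hits q
  else if (A.hits q).Nonempty ∧ T = ∅ then Finset.univ \ A.hits q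
  else T

/-- The E-LDGBA may move into `q'` when the frontier is `T`: either `q'` is in no accepting set, or
it is in an accepting set of the frontier, or `T` is empty (so that it is reset to the whole family
of accepting sets). -/
def Admissible (A : LDGBA AP Q f) (T : Finset (Fin f)) (q' : Q) : Prop :=
  (∀ j, q' ∉ A.F j) ∨ (∃ j ∈ T, q' ∈ A.F j) ∨ T = ∅

/-- The transition function of the E-LDGBA at the automaton state `q` with frontier `T`. -/
def δbar (A : LDGBA AP Q f) (q : Q) (T : Finset (Fin f)) (ι : Option (Finset AP)) : Set Q :=
  {q' | q' ∈ A.δ q ι ∧ A.Admissible T q'}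

end LDGBA

section Violation

variable {AP : Type*} [Fintype AP]

open scoped Classical in
/-- The evaluation vector in `{0,1}^AP` of a label. -/
def labelEval (l : Finset AP) (i : AP) : ℝ := if i ∈ l then 1 else 0

/-- The `ℓ¹` distance of two labels. -/
def labelDist (l l' : Finset AP) : ℝ := ∑ i, |labelEval l i - labelEval l' i|

open scoped Classical in
/-- The distance of a label to a set of labels (a minimum, as there are finitely many labels). -/
def labelSetDist (l : Finset AP) (Z : Set (Finset AP)) : ℝ :=
  if l ∈ Z then 0 else sInf (labelDist l '' Z)

end Violation

/-- The pairs `(s, l)` with `l ∈ L(s)` and `p_L(s, l) > 0`. -/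
abbrev LState {S Act AP : Type*} [Fintype S] (M : LabeledMDP S Act AP) : Type _ :=
  {y : S × Finset AP // y.2 ∈ M.L y.1 ∧ 0 < M.pL y.1 y.2}

/-- States `((s, l), q, T)` of the relaxed product MDP, `T` being the current tracking frontier. -/
abbrev RState {S Act AP Q : Type*} {f : ℕ} [Fintype S]
    (M : LabeledMDP S Act AP) (_A : LDGBA AP Q f) : Type _ :=
  LState M × Q × Finset (Fin f)

/-- Actions of the relaxed product MDP: an action of the MDP, an input symbol of the automaton, and
the successor automaton state, which resolves the nondeterminism of the automaton (the last
component is determined by the others wherever the automaton has a single successor). -/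
structure RAction (Act AP Q : Type*) where
  act : Act
  sym : Option (Finset AP)
  next : Q

/-- Actions as triples. -/
def RAction.equiv (Act AP Q : Type*) :
    RAction Act AP Q ≃ Act × Option (Finset AP) × Q where
  toFun u := (u.act, u.sym, u.next)
  invFun v := ⟨v.1, v.2.1, v.2.2⟩
  left_inv _ := rfl
  right_inv _ := rfl

instance {Act AP Q : Type*} [Fintype Act] [Fintype AP] [Fintype Q] :
    Fintype (RAction Act AP Q) :=
  Fintype.ofEquiv _ (RAction.equiv Act AP Q).symm

namespace Relaxed

variable {S Act AP Q : Type*} {f : ℕ} [Fintype S] [Fintype Act] [Fintype AP] [Fintype Q]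

instance (M : LabeledMDP S Act AP) : Fintype (LState M) := Fintype.ofFinite _

instance (M : LabeledMDP S Act AP) (A : LDGBA AP Q f) : DecidableEq (RState M A) :=
  Classical.decEq _

variable (M : LabeledMDP S Act AP) (A : LDGBA AP Q f)

/-- The initial state `(s₀, l₀, q₀)`, with the frontier initialized to all accepting sets. -/
def init : RState M A := (⟨(M.s₀, M.l₀), M.l₀_mem, M.l₀_pos⟩, A.q₀, Finset.univ)

variable {M}

/-- The accepting set `F_i` of the relaxed product MDP. -/
def accSet (i : Fin f) : Set (RState M A) := {x | x.2.1 ∈ A.F i}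

/-- The actions available at `x`: the MDP component is available at `s`, and the automaton
component is a transition of the E-LDGBA. -/
def Available (x : RState M A) (u : RAction Act AP Q) : Prop :=
  u.act ∈ M.avail x.1.1.1 ∧ u.next ∈ A.δbar x.2.1 x.2.2 u.sym

open scoped Classical in
/-- The transition function of the relaxed product MDP. -/
def pR (x : RState M A) (u : RAction Act AP Q) (x' : RState M A) : ℝ :=
  if u.next ∈ A.δbar x.2.1 x.2.2 u.sym ∧ x'.2.1 = u.next ∧
      x'.2.2 = A.frontier u.next x.2.2 then
    match u.sym with
    | some _ => M.pL x'.1.1.1 x'.1.1.2 * M.pS x.1.1.1 u.act x'.1.1.1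
    | none => if x'.1 = x.1 then 1 else 0
  else 0

/-- The violation cost: the distance from the current label to the labels that enable the
transition of the automaton, and zero for `ε`-transitions. -/
def cV (x : RState M A) (u : RAction Act AP Q) (x' : RState M A) : ℝ :=
  match u.sym with
  | some _ => labelSetDist x.1.1.2 {l | x'.2.1 ∈ A.δ x.2.1 (some l)}
  | none => 0

open scoped Classical in
/-- The accepting reward. -/
def accReward (r : ℝ) (x : RState M A) : ℝ := if ∃ i, x ∈ accSet A i then r else 0

variable (M)

/-- A (memoryless, randomized) action function of the relaxed product MDP: at every state it picks
an available action, if there is one. A state without available actions has no successor. -/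
structure Policy where
  w : RState M A → RAction Act AP Q → ℝ
  nonneg : ∀ x u, 0 ≤ w x u
  supp : ∀ x u, w x u ≠ 0 → Available A x u
  sum_one : ∀ x, (∃ u, Available A x u) → ∑ u, w x u = 1

variable {M} {A}

/-- Deterministic policies put all their weight on one action. -/
def Policy.IsDeterministic (π : Policy M A) : Prop := ∀ x u, π.w x u = 0 ∨ π.w x u = 1

/-- The transition matrix `P_π` of the chain induced by `π`; its rows sum to `1`, except for the
zero rows of the states without available actions. -/
def Policy.P (π : Policy M A) : Matrix (RState M A) (RState M A) ℝ :=
  fun x x' => ∑ u, π.w x u * pR A x u x'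

/-- The matrix `V_π` of violation rewards `-c_V`, weighted by the transition probabilities. -/
def Policy.V (π : Policy M A) : Matrix (RState M A) (RState M A) ℝ :=
  fun x x' => ∑ u, π.w x u * (pR A x u x' * (-cV A x u x'))

/-- The expected discounted return
`∑ γ^n P_π^n (Λ + β V_π 1)` of a stationary policy, as a function of the initial state. -/
def Policy.discountedReturn (π : Policy M A) (r β γ : ℝ) (x : RState M A) : ℝ :=
  ∑' n : ℕ, γ ^ n * ((π.P ^ n).mulVec (accReward A r + β • π.V.mulVec 1)) x

/-- `π` maximizes the expected return, at every state, among the stationary policies in `C`. -/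
def IsOptimal (C : Set (Policy M A)) (r β γ : ℝ) (π : Policy M A) : Prop :=
  π ∈ C ∧ ∀ π' ∈ C, ∀ x, π'.discountedReturn r β γ x ≤ π.discountedReturn r β γ x

theorem pR_nonneg (x : RState M A) (u : RAction Act AP Q) (x' : RState M A) :
    0 ≤ pR A x u x' := by
  unfold pR
  by_cases h : u.next ∈ A.δbar x.2.1 x.2.2 u.sym ∧ x'.2.1 = u.next ∧
      x'.2.2 = A.frontier u.next x.2.2
  · rw [if_pos h]
    split
    · exact mul_nonneg (M.pL_nonneg _ _) (M.pS_nonneg _ _ _)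
    · by_cases h' : x'.1 = x.1 <;> simp [h']
  · rw [if_neg h]

theorem sum_pL_pS (s : S) (a : Act) (ha : a ∈ M.avail s) :
    ∑ y : LState M, M.pL y.1.1 y.1.2 * M.pS s a y.1.1 = 1 := by
  classical
  rw [← Finset.sum_subtype (Finset.univ.filter
    fun y : S × Finset AP => y.2 ∈ M.L y.1 ∧ 0 < M.pL y.1 y.2) (by simp)
    (fun y => M.pL y.1 y.2 * M.pS s a y.1), Finset.sum_filter, Fintype.sum_prod_type,
    ← M.pS_sum s a ha]
  refine Finset.sum_congr rfl fun s' _ => ?_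
  have h : ∀ l : Finset AP, (if l ∈ M.L s' ∧ 0 < M.pL s' l then M.pL s' l * M.pS s a s' else 0) =
      if l ∈ M.L s' then M.pL s' l * M.pS s a s' else 0 := by
    intro l
    by_cases h1 : l ∈ M.L s'
    · rcases (M.pL_nonneg s' l).eq_or_lt with h2 | h2
      · simp [← h2]
      · simp [h1, h2]
    · simp [h1]
  simp only [h]
  rw [← Finset.sum_filter, Finset.filter_mem_eq_inter, Finset.univ_inter, ← Finset.sum_mul,
    M.pL_sum, one_mul]

/-- The transition function of the relaxed product MDP is a probability distribution for every
available action. -/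
theorem sum_pR (x : RState M A) (u : RAction Act AP Q) (hu : Available A x u) :
    ∑ x', pR A x u x' = 1 := by
  classical
  have h : ∀ x' : RState M A, pR A x u x' =
      if x'.2 = (u.next, A.frontier u.next x.2.2) then
        (match u.sym with
          | some _ => M.pL x'.1.1.1 x'.1.1.2 * M.pS x.1.1.1 u.act x'.1.1.1
          | none => if x'.1 = x.1 then 1 else 0)
      else 0 := by
    intro x'
    simp [pR, hu.2, Prod.ext_iff]
  simp only [h]
  rw [Fintype.sum_prod_type]
  simp only [Finset.sum_ite_eq', Finset.mem_univ, if_true]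
  cases hs : u.sym with
  | some _ => exact sum_pL_pS _ _ hu.1
  | none => simp

theorem Policy.P_nonneg (π : Policy M A) (x x' : RState M A) : 0 ≤ π.P x x' :=
  Finset.sum_nonneg fun u _ => mul_nonneg (π.nonneg x u) (pR_nonneg x u x')

theorem Policy.sum_P_le_one (π : Policy M A) (x : RState M A) : ∑ x', π.P x x' ≤ 1 := by
  unfold Policy.P
  rw [Finset.sum_comm]
  have h : ∀ u, ∑ x', π.w x u * pR A x u x' = π.w x u := by
    intro u
    rw [← Finset.mul_sum]
    by_cases hu : π.w x u = 0
    · simp [hu]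
    · rw [sum_pR x u (π.supp x u hu), mul_one]
  simp only [h]
  by_cases hx : ∃ u, Available A x u
  · exact (π.sum_one x hx).le
  · have h0 : ∀ u, π.w x u = 0 := fun u => by
      by_contra hu
      exact hx ⟨u, π.supp x u hu⟩
    simp [h0]

variable (M A) in
/-- The configurations of the induced chain: a state, or `none` once the run has ended in a state
without available actions. -/
abbrev Config : Type _ := Option (RState M A)

instance : MeasurableSpace (Config M A) := ⊤

instance : DiscreteMeasurableSpace (Config M A) := ⟨fun _ => trivial⟩

/-- One step of the induced chain, with the defect of the rows of `P_π` moved to `none`. -/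
def Policy.step (π : Policy M A) : Config M A → Config M A → ℝ
  | none, none => 1
  | none, some _ => 0
  | some x, none => 1 - ∑ x', π.P x x'
  | some x, some x' => π.P x x'

theorem Policy.step_nonneg (π : Policy M A) (c c' : Config M A) : 0 ≤ π.step c c' := by
  match c, c' with
  | none, none => exact zero_le_one
  | none, some _ => exact le_rfl
  | some x, none => exact sub_nonneg.2 (π.sum_P_le_one x)
  | some x, some x' => exact π.P_nonneg x x'

theorem Policy.sum_step (π : Policy M A) (c : Config M A) : ∑ c', π.step c c' = 1 := by
  refine (Fintype.sum_option fun c' => π.step c c').trans ?_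
  match c with
  | none => simp [Policy.step]
  | some x => simp [Policy.step]

/-- The distribution of the next configuration. -/
def Policy.stepPMF (π : Policy M A) (c : Config M A) : PMF (Config M A) :=
  PMF.ofFintype (fun c' => ENNReal.ofReal (π.step c c')) (by
    rw [← ENNReal.ofReal_sum_of_nonneg fun c' _ => π.step_nonneg c c', π.sum_step c,
      ENNReal.ofReal_one])

/-- The Markov kernel of the chain induced by `π`, as a function of the finite past. -/
def Policy.kernel (π : Policy M A) (n : ℕ) :
    Kernel (Π _ : Finset.Iic n, Config M A) (Config M A) :=
  Kernel.ofFunOfCountable fun h => (π.stepPMF (h ⟨n, Finset.mem_Iic.2 le_rfl⟩)).toMeasure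

instance (π : Policy M A) (n : ℕ) : IsMarkovKernel (π.kernel n) :=
  ⟨fun h => by
    change IsProbabilityMeasure (PMF.toMeasure _)
    infer_instance⟩

/-- The law of the run induced by the stationary policy `π` from the initial state. -/
def Policy.runLaw (π : Policy M A) : Measure (ℕ → Config M A) :=
  Kernel.trajMeasure (X := fun _ => Config M A)
    (Measure.dirac (some (init M A))) π.kernel

/-- The generalized Büchi acceptance condition: for every `i`, some state of `F_i` is visited
infinitely often. -/
def Accepted (ω : ℕ → Config M A) : Prop :=
  ∀ i, ∃ x ∈ accSet A i, ∃ᶠ n in atTop, ω n = some x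

/-- A stationary policy satisfies the acceptance condition if almost every run that it induces from
the initial state does. -/
def Policy.Satisfies (π : Policy M A) : Prop := ∀ᵐ ω ∂π.runLaw, Accepted ω

variable (M A) in
/-- A general control policy `ξ₀ ξ₁ …`: the action function used at each stage may depend on the
past states. -/
abbrev ControlPolicy : Type _ := List (RState M A) → Policy M A

/-- `ρ` is an infinite run that the control policy `ξ` can produce from the initial state: each of
its transitions has positive probability under the action function in force. -/
def IsInducedRun (ξ : ControlPolicy M A) (ρ : ℕ → RState M A) : Prop :=
  ρ 0 = init M A ∧ ∀ n, 0 < (ξ (List.ofFn fun k : Fin n => ρ k)).P (ρ n) (ρ (n + 1))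

end Relaxed

end

/-! In the relaxed product the automaton may read any letter at any state, mismatches being merely
charged. Hence the pair `(q, T)` is fully controlled: an action determines the next pair, whatever
the MDP does. Everything is decided on the finite graph of these pairs. Call a pair good if it can
reach an accepting pair lying on a cycle.

From a good state, following shortest paths to such a pair and then returning again and again
collects `r` at bounded intervals, at a violation cost per step that is small against `r`. The
return thus grows like `r / (1 - γ)` (`le_discountedReturn_of_rank`). From a bad state no accepting
pair can be visited twice, so every return is at most `r` times the number of pairs
(`Policy.discountedReturn_le_count`). For `γ` near 1, stepping from good to bad violates the Bellman
equation; an optimal policy therefore stays among the good states and has positive return there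
(`exists_bounds_optimal`). The starting pair is good because an accepted run repeats a state of `F
0`.

Positive return forces recurrence. If accepting states could be avoided forever with positive
probability, the good states where this probability is maximal would form a closed set without
accepting states, on which the return is at most zero (`Policy.tendsto_avoid`). So accepting states
recur almost surely. Finally the frontier turns infinitely many accepting visits into infinitely
many visits to each `F i` (`LDGBA.frequently_mem_of_frequently_acc`). -/

open scoped Topology

/-! ### Discounted sums for substochastic matrices -/

/-- A discounted subsolution of a substochastic matrix is nonpositive on every closed set. -/
theorem Matrix.nonpos_of_le_discounted {X : Type*} [Fintype X] {P : Matrix X X ℝ}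
    (hP : ∀ x y, 0 ≤ P x y) (hP1 : ∀ x, ∑ y, P x y ≤ 1) {γ : ℝ} (h0 : 0 ≤ γ) (h1 : γ < 1)
    {s : Set X} (hs : ∀ x ∈ s, ∀ y, P x y ≠ 0 → y ∈ s) {v : X → ℝ}
    (hv : ∀ x ∈ s, v x ≤ γ * ∑ y, P x y * v y) : ∀ x ∈ s, v x ≤ 0 := by
  intro x hx
  obtain ⟨m, hm, hmax⟩ := s.toFinite.exists_maximalFor v s ⟨x, hx⟩
  have hle : ∀ y ∈ s, v y ≤ v m := fun y hy => by
    by_contra! h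
    exact absurd (hmax hy h.le) (not_le.2 h)
  refine (hle x hx).trans ?_
  by_contra! hpos
  have hsum : ∑ y, P m y * v y ≤ v m := calc
    ∑ y, P m y * v y ≤ ∑ y, P m y * v m := by
      refine Finset.sum_le_sum fun y _ => ?_
      by_cases hy : P m y = 0
      · simp [hy]
      · exact mul_le_mul_of_nonneg_left (hle y (hs m hm y hy)) (hP m y)
    _ = (∑ y, P m y) * v m := by rw [Finset.sum_mul]
    _ ≤ 1 * v m := mul_le_mul_of_nonneg_right (hP1 m) hpos.le
    _ = v m := one_mul _
  nlinarith [hv m hm, mul_le_mul_of_nonneg_left hsum h0]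

theorem Matrix.abs_pow_mulVec_le {X : Type*} [Fintype X] [DecidableEq X] {P : Matrix X X ℝ}
    (hP : ∀ x y, 0 ≤ P x y) (hP1 : ∀ x, ∑ y, P x y ≤ 1) {v : X → ℝ} {c : ℝ}
    (hv : ∀ x, |v x| ≤ c) (n : ℕ) (x : X) : |(P ^ n).mulVec v x| ≤ c := by
  induction n generalizing x with
  | zero => simpa using hv x
  | succ n ih =>
    rw [pow_succ', ← Matrix.mulVec_mulVec]
    calc |∑ y, P x y * (P ^ n).mulVec v y|
        ≤ ∑ y, |P x y * (P ^ n).mulVec v y| := Finset.abs_sum_le_sum_abs _ _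
      _ ≤ ∑ y, P x y * c := by
          refine Finset.sum_le_sum fun y _ => ?_
          rw [abs_mul, abs_of_nonneg (hP x y)]
          exact mul_le_mul_of_nonneg_left (ih y) (hP x y)
      _ = (∑ y, P x y) * c := by rw [Finset.sum_mul]
      _ ≤ 1 * c := mul_le_mul_of_nonneg_right (hP1 x) ((abs_nonneg _).trans (hv x))
      _ = c := one_mul c

theorem Matrix.tsum_discounted_eq {X : Type*} [Fintype X] [DecidableEq X] {P : Matrix X X ℝ}
    (hP : ∀ x y, 0 ≤ P x y) (hP1 : ∀ x, ∑ y, P x y ≤ 1) {γ : ℝ} (h0 : 0 ≤ γ) (h1 : γ < 1)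
    (v : X → ℝ) (x : X) :
    ∑' n : ℕ, γ ^ n * (P ^ n).mulVec v x =
      v x + γ * ∑ y, P x y * ∑' n : ℕ, γ ^ n * (P ^ n).mulVec v y := by
  obtain ⟨c, hc⟩ : ∃ c, ∀ y, |v y| ≤ c :=
    ⟨∑ y, |v y|, fun y => Finset.single_le_sum (f := fun y => |v y|)
      (fun _ _ => abs_nonneg _) (Finset.mem_univ y)⟩
  have hsum : ∀ y, Summable fun n : ℕ => γ ^ n * (P ^ n).mulVec v y := fun y => by
    refine Summable.of_norm_bounded ((summable_geometric_of_lt_one h0 h1).mul_right c) fun n => ?_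
    rw [Real.norm_eq_abs, abs_mul, abs_of_nonneg (pow_nonneg h0 n)]
    exact mul_le_mul_of_nonneg_left (abs_pow_mulVec_le hP hP1 hc n y) (pow_nonneg h0 n)
  rw [(hsum x).tsum_eq_zero_add]
  congr 1
  · simp
  · have h : ∀ n : ℕ, γ ^ (n + 1) * (P ^ (n + 1)).mulVec v x =
        γ * ∑ y, P x y * (γ ^ n * (P ^ n).mulVec v y) := fun n => by
      rw [pow_succ' P, ← Matrix.mulVec_mulVec]
      simp only [Matrix.mulVec, dotProduct, Finset.mul_sum]
      refine Finset.sum_congr rfl fun y _ => Finset.sum_congr rfl fun z _ => ?_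
      ring
    simp only [h]
    rw [tsum_mul_left, Summable.tsum_finsetSum fun y _ => (hsum y).mul_left _]
    simp only [tsum_mul_left]

/-! ### Bellman equation and policy improvement -/

noncomputable section

namespace Relaxed

variable {S Act AP Q : Type*} {f : ℕ} [Fintype S] [Fintype Act] [Fintype AP] [Fintype Q]
variable {M : LabeledMDP S Act AP} {A : LDGBA AP Q f}

/-- The part of the one-step return under the action `u` that depends on `u`, when the successor
states are valued with `v`. -/
def gain (β γ : ℝ) (v : RState M A → ℝ) (x : RState M A) (u : RAction Act AP Q) : ℝ :=
  ∑ x', pR A x u x' * (γ * v x' - β * cV A x u x')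

theorem gain_sub_gain (β γ : ℝ) (v w : RState M A → ℝ) (x : RState M A) (u : RAction Act AP Q) :
    gain β γ v x u - gain β γ w x u = γ * ∑ x', pR A x u x' * (v x' - w x') := by
  unfold gain
  rw [← Finset.sum_sub_distrib, Finset.mul_sum]
  exact Finset.sum_congr rfl fun _ _ => by ring

theorem gain_mono {β γ : ℝ} (hγ : 0 ≤ γ) {v w : RState M A → ℝ} (h : ∀ x, v x ≤ w x)
    (x : RState M A) (u : RAction Act AP Q) : gain β γ v x u ≤ gain β γ w x u :=
  Finset.sum_le_sum fun y _ => mul_le_mul_of_nonneg_left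
    (sub_le_sub_right (mul_le_mul_of_nonneg_left (h y) hγ) _) (pR_nonneg x u y)

namespace Policy

variable (π : Policy M A)

theorem sum_P_mul (v : RState M A → ℝ) (x : RState M A) :
    ∑ x', π.P x x' * v x' = ∑ u, π.w x u * ∑ x', pR A x u x' * v x' := by
  simp only [Policy.P, Finset.sum_mul, Finset.mul_sum]
  rw [Finset.sum_comm]
  exact Finset.sum_congr rfl fun _ _ => Finset.sum_congr rfl fun _ _ => by ring

theorem discountedReturn_eq {r β γ : ℝ} (h0 : 0 ≤ γ) (h1 : γ < 1) (x : RState M A) :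
    π.discountedReturn r β γ x =
      accReward A r x + ∑ u, π.w x u * gain β γ (π.discountedReturn r β γ) x u := by
  have h := Matrix.tsum_discounted_eq π.P_nonneg π.sum_P_le_one h0 h1
    (accReward A r + β • π.V.mulVec 1) x
  change π.discountedReturn r β γ x = _ + γ * ∑ y, π.P x y * π.discountedReturn r β γ y at h
  rw [h, sum_P_mul]
  simp only [Pi.add_apply, Pi.smul_apply, smul_eq_mul, Matrix.mulVec, dotProduct, Policy.V,
    Pi.one_apply, mul_one, add_assoc, gain]
  rw [Finset.sum_comm, Finset.mul_sum, Finset.mul_sum, ← Finset.sum_add_distrib]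
  congr 1
  refine Finset.sum_congr rfl fun u _ => ?_
  rw [Finset.mul_sum, Finset.mul_sum, Finset.mul_sum, Finset.mul_sum, ← Finset.sum_add_distrib]
  exact Finset.sum_congr rfl fun _ _ => by ring

/-- Under `π`, the set of states `s` is never left. -/
def Closed (s : Set (RState M A)) : Prop := ∀ x ∈ s, ∀ y, π.P x y ≠ 0 → y ∈ s

variable {π}

/-- Comparison principle: the return minus a supersolution `W` is a discounted subsolution of `P_π`,
hence nonpositive on the closed set. Only values of `W` on `s` matter, which permits separate
estimates on good and bad states. -/
theorem discountedReturn_le {r β γ : ℝ} (h0 : 0 ≤ γ) (h1 : γ < 1) {s : Set (RState M A)}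
    (hs : π.Closed s) {W : RState M A → ℝ}
    (hW : ∀ x ∈ s, accReward A r x + ∑ u, π.w x u * gain β γ W x u ≤ W x) :
    ∀ x ∈ s, π.discountedReturn r β γ x ≤ W x := by
  intro x hx
  refine sub_nonpos.1 (Matrix.nonpos_of_le_discounted π.P_nonneg π.sum_P_le_one h0 h1 hs
    (v := fun x => π.discountedReturn r β γ x - W x) (fun y hy => ?_) x hx)
  have h2 : ∑ u, π.w y u * gain β γ (π.discountedReturn r β γ) y u -
      ∑ u, π.w y u * gain β γ W y u =
      γ * ∑ z, π.P y z * (π.discountedReturn r β γ z - W z) := by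
    rw [sum_P_mul, ← Finset.sum_sub_distrib, Finset.mul_sum]
    refine Finset.sum_congr rfl fun u _ => ?_
    rw [← mul_sub, gain_sub_gain]
    ring
  linarith [hW y hy, π.discountedReturn_eq (r := r) (β := β) h0 h1 y]

theorem le_discountedReturn {r β γ : ℝ} (h0 : 0 ≤ γ) (h1 : γ < 1) {s : Set (RState M A)}
    (hs : π.Closed s) {W : RState M A → ℝ}
    (hW : ∀ x ∈ s, W x ≤ accReward A r x + ∑ u, π.w x u * gain β γ W x u) :
    ∀ x ∈ s, W x ≤ π.discountedReturn r β γ x := by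
  intro x hx
  refine sub_nonpos.1 (Matrix.nonpos_of_le_discounted π.P_nonneg π.sum_P_le_one h0 h1 hs
    (v := fun x => W x - π.discountedReturn r β γ x) (fun y hy => ?_) x hx)
  have h2 : ∑ u, π.w y u * gain β γ W y u -
      ∑ u, π.w y u * gain β γ (π.discountedReturn r β γ) y u =
      γ * ∑ z, π.P y z * (W z - π.discountedReturn r β γ z) := by
    rw [sum_P_mul, ← Finset.sum_sub_distrib, Finset.mul_sum]
    refine Finset.sum_congr rfl fun u _ => ?_
    rw [← mul_sub, gain_sub_gain]
    ring
  linarith [hW y hy, π.discountedReturn_eq (r := r) (β := β) h0 h1 y]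

theorem closed_univ : π.Closed Set.univ := fun _ _ _ _ => trivial

end Policy

variable (M A) in
/-- A choice of an available action at every state that has one. -/
abbrev Selection : Type _ :=
  {g : RState M A → RAction Act AP Q // ∀ x, (∃ u, Available A x u) → Available A x (g x)}

theorem exists_selection {p : RState M A → RAction Act AP Q → Prop}
    (hp : ∀ x u, p x u → Available A x u) :
    ∃ g : Selection M A, ∀ x, (∃ u, p x u) → p x (g.1 x) := by
  classical
  -- A dummy value for states without available actions; `Selection.policy` gives it weight zero.
  have a : RAction Act AP Q := ⟨(M.avail_nonempty M.s₀).choose, none, A.q₀⟩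
  have h : ∀ x : RState M A, ∃ u, ((∃ u, Available A x u) → Available A x u) ∧
      ((∃ u, p x u) → p x u) := fun x => by
    by_cases h1 : ∃ u, p x u
    · exact ⟨h1.choose, fun _ => hp _ _ h1.choose_spec, fun _ => h1.choose_spec⟩
    · by_cases h2 : ∃ u, Available A x u
      · exact ⟨h2.choose, fun _ => h2.choose_spec, fun h => absurd h h1⟩
      · exact ⟨a, fun h => absurd h h2, fun h => absurd h h1⟩
  choose g hg using h
  exact ⟨⟨g, fun x => (hg x).1⟩, fun x => (hg x).2⟩

namespace Selection

open scoped Classical in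
/-- The deterministic policy given by a selection. -/
def policy (g : Selection M A) : Policy M A where
  w x u := if Available A x u ∧ u = g.1 x then 1 else 0
  nonneg x u := by positivity
  supp x u h := by
    by_contra hu
    simp [hu] at h
  sum_one x hx := by
    rw [Finset.sum_eq_single (g.1 x) (fun u _ hu => by simp [hu]) (by simp),
      if_pos ⟨g.2 x hx, rfl⟩]

theorem isDeterministic (g : Selection M A) : g.policy.IsDeterministic := fun x u => by
  simp only [policy]
  split_ifs <;> simp

theorem sum_w_mul_of_available (g : Selection M A) {x : RState M A}
    (hx : ∃ u, Available A x u) (h : RAction Act AP Q → ℝ) :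
    ∑ u, g.policy.w x u * h u = h (g.1 x) := by
  rw [Finset.sum_eq_single (g.1 x) (fun u _ hu => by simp [policy, hu]) (by simp)]
  simp [policy, g.2 x hx]

end Selection

theorem Policy.w_eq_zero_of_not_available (π : Policy M A) {x : RState M A}
    (hx : ¬ ∃ u, Available A x u) (u : RAction Act AP Q) : π.w x u = 0 := by
  by_contra h
  exact hx ⟨u, π.supp x u h⟩

/-- Some deterministic policy cannot be improved by a change of a single action. -/
theorem exists_selection_bellman (r β : ℝ) {γ : ℝ} (h0 : 0 ≤ γ) (h1 : γ < 1) :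
    ∃ g : Selection M A, ∀ x u, Available A x u →
      accReward A r x + gain β γ (g.policy.discountedReturn r β γ) x u ≤
        g.policy.discountedReturn r β γ x := by
  classical
  have : Nonempty (Selection M A) :=
    (exists_selection (p := Available A) fun _ _ h => h).nonempty
  -- There are finitely many selections. Maximizing the sum of the returns over all states turns a
  -- pointwise improvement that is strict somewhere into a contradiction.
  obtain ⟨g, hg⟩ := Finite.exists_max fun g : Selection M A =>
    ∑ x, g.policy.discountedReturn r β γ x
  refine ⟨g, fun x u hu => ?_⟩
  by_contra! hlt
  let g' : Selection M A := ⟨Function.update g.1 x u, fun y hy => by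
    by_cases hyx : y = x
    · subst hyx; simpa using hu
    · simpa [hyx] using g.2 y hy⟩
  have hg'x : g'.1 x = u := by simp [g']
  have hg'y : ∀ y, y ≠ x → g'.1 y = g.1 y := fun y hy => by simp [g', hy]
  -- The old return is a subsolution for the modified policy: strict at `x`, with equality
  -- elsewhere.
  have hle : ∀ y, g.policy.discountedReturn r β γ y ≤ g'.policy.discountedReturn r β γ y := by
    intro y
    refine Policy.le_discountedReturn h0 h1 Policy.closed_univ (fun z _ => ?_) y trivial
    by_cases hz : ∃ u, Available A z u
    · rw [g'.sum_w_mul_of_available hz]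
      by_cases hzx : z = x
      · subst hzx
        rw [hg'x]
        exact hlt.le
      · rw [hg'y z hzx, g.policy.discountedReturn_eq h0 h1, g.sum_w_mul_of_available hz]
    · rw [g.policy.discountedReturn_eq h0 h1]
      simp [Policy.w_eq_zero_of_not_available _ hz]
  have hx : g.policy.discountedReturn r β γ x < g'.policy.discountedReturn r β γ x := by
    rw [g'.policy.discountedReturn_eq h0 h1, g'.sum_w_mul_of_available ⟨u, hu⟩, hg'x]
    exact hlt.trans_le (by gcongr; exact gain_mono h0 hle x u)
  exact absurd (hg g') (not_le.2 (Finset.sum_lt_sum (fun y _ => hle y) ⟨x, Finset.mem_univ x, hx⟩))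

theorem Policy.discountedReturn_le_of_bellman (π : Policy M A) {r β γ : ℝ} (h0 : 0 ≤ γ)
    (h1 : γ < 1) {W : RState M A → ℝ} (hacc : ∀ x, (¬ ∃ u, Available A x u) → accReward A r x ≤ W x)
    (hW : ∀ x u, Available A x u → accReward A r x + gain β γ W x u ≤ W x) (x : RState M A) :
    π.discountedReturn r β γ x ≤ W x := by
  refine discountedReturn_le h0 h1 closed_univ (fun y _ => ?_) x trivial
  by_cases hy : ∃ u, Available A y u
  · have h : ∑ u, π.w y u * gain β γ W y u ≤ ∑ u, π.w y u * (W y - accReward A r y) := by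
      refine Finset.sum_le_sum fun u _ => ?_
      by_cases hu : π.w y u = 0
      · simp [hu]
      · exact mul_le_mul_of_nonneg_left (by linarith [hW y u (π.supp y u hu)]) (π.nonneg y u)
    rw [← Finset.sum_mul, π.sum_one y hy] at h
    linarith
  · simpa [π.w_eq_zero_of_not_available hy] using hacc y hy

end Relaxed

end

/-! ### Bounds on the violation cost -/

theorem labelDist_nonneg {AP : Type*} [Fintype AP] (l l' : Finset AP) : 0 ≤ labelDist l l' :=
  Finset.sum_nonneg fun _ _ => abs_nonneg _

theorem labelDist_le {AP : Type*} [Fintype AP] (l l' : Finset AP) :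
    labelDist l l' ≤ Fintype.card AP := by
  have h : ∀ i, |labelEval l i - labelEval l' i| ≤ 1 := fun i => by
    unfold labelEval
    split_ifs <;> simp
  exact (Finset.sum_le_sum fun i _ => h i).trans (by simp)

theorem labelSetDist_nonneg {AP : Type*} [Fintype AP] (l : Finset AP) (Z : Set (Finset AP)) :
    0 ≤ labelSetDist l Z := by
  unfold labelSetDist
  split_ifs
  · rfl
  · exact Real.sInf_nonneg (by rintro _ ⟨l', _, rfl⟩; exact labelDist_nonneg l l')

theorem labelSetDist_le {AP : Type*} [Fintype AP] (l : Finset AP) (Z : Set (Finset AP)) :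
    labelSetDist l Z ≤ Fintype.card AP := by
  unfold labelSetDist
  split_ifs
  · positivity
  · rcases Z.eq_empty_or_nonempty with rfl | ⟨l', hl'⟩
    · simp
    · exact (csInf_le ⟨0, by rintro _ ⟨l', _, rfl⟩; exact labelDist_nonneg l l'⟩
        (Set.mem_image_of_mem _ hl')).trans (labelDist_le l l')

/-! ### The graph of automaton states with frontiers -/

namespace LDGBA

variable {AP Q : Type*} {f : ℕ} (A : LDGBA AP Q f)

/-- The transitions of the E-LDGBA, with the frontier made part of the state. -/
def Edge (y y' : Q × Finset (Fin f)) : Prop :=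
  ∃ ι, y'.1 ∈ A.δbar y.1 y.2 ι ∧ y'.2 = A.frontier y'.1 y.2

/-- The automaton component lies in an accepting set. -/
def Acc (y : Q × Finset (Fin f)) : Prop := ∃ i, y.1 ∈ A.F i

/-- An accepting state on a cycle is reached in exactly `n` transitions. -/
def Reach : ℕ → Q × Finset (Fin f) → Prop
  | 0, y => A.Acc y ∧ Relation.TransGen A.Edge y y
  | n + 1, y => ∃ y', A.Edge y y' ∧ Reach n y'

/-- An accepting state on a cycle can be reached. -/
def Good (y : Q × Finset (Fin f)) : Prop := ∃ n, A.Reach n y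

variable {A}

theorem Good.of_edge {y y' : Q × Finset (Fin f)} (h : A.Edge y y') : A.Good y' → A.Good y :=
  fun ⟨n, hn⟩ => ⟨n + 1, y', h, hn⟩

theorem Good.of_reflTransGen {y y' : Q × Finset (Fin f)}
    (h : Relation.ReflTransGen A.Edge y y') (hy' : A.Good y') : A.Good y := by
  induction h using Relation.ReflTransGen.head_induction_on with
  | refl => exact hy'
  | head h _ ih => exact ih.of_edge h

variable (A) in
/-- The least number of transitions to an accepting state on a cycle. -/
noncomputable def rank (y : Q × Finset (Fin f)) : ℕ := sInf {n | A.Reach n y}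

/-- At rank zero the walk goes on along the cycle. The rank may then jump up, but only at an
accepting pair, where the reward pays for it. -/
theorem Good.exists_edge {y : Q × Finset (Fin f)} (h : A.Good y) :
    ∃ y', A.Edge y y' ∧ A.Good y' ∧ (A.Acc y ∨ A.rank y' + 1 ≤ A.rank y) := by
  have hr : A.Reach (A.rank y) y := Nat.sInf_mem h
  cases hn : A.rank y with
  | zero =>
    rw [hn] at hr
    obtain ⟨y', h1, h2⟩ := Relation.TransGen.head'_iff.1 hr.2
    exact ⟨y', h1, Good.of_reflTransGen h2 ⟨0, hr⟩, Or.inl hr.1⟩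
  | succ n =>
    rw [hn] at hr
    obtain ⟨y', h1, h2⟩ := hr
    exact ⟨y', h1, ⟨n, h2⟩, Or.inr (Nat.succ_le_succ (Nat.sInf_le h2))⟩

variable (A) in
/-- The number of accepting states that can be reached. -/
noncomputable def count (y : Q × Finset (Fin f)) : ℕ :=
  Set.ncard {z | A.Acc z ∧ Relation.ReflTransGen A.Edge y z}

theorem count_le_of_edge [Finite Q] {y y' : Q × Finset (Fin f)} (h : A.Edge y y') :
    A.count y' ≤ A.count y :=
  Set.ncard_le_ncard (fun _ hz => ⟨hz.1, hz.2.head h⟩) (Set.toFinite _)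

/-- A bad accepting pair is on no cycle, so it is no longer reachable once it has been left. -/
theorem count_lt_of_edge [Finite Q] {y y' : Q × Finset (Fin f)} (h : A.Edge y y')
    (hy : A.Acc y) (hbad : ¬ A.Good y) : A.count y' < A.count y :=
  Set.ncard_lt_ncard ⟨fun _ hz => ⟨hz.1, hz.2.head h⟩, fun hsub =>
    hbad ⟨0, hy, Relation.TransGen.head' h (hsub ⟨hy, .refl⟩).2⟩⟩ (Set.toFinite _)

end LDGBA

/-! ### Return bounds on good and bad states -/

noncomputable section

namespace Relaxed

variable {S Act AP Q : Type*} {f : ℕ} [Fintype S] [Fintype Act] [Fintype AP] [Fintype Q]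
variable {M : LabeledMDP S Act AP} {A : LDGBA AP Q f}

theorem cV_nonneg (x : RState M A) (u : RAction Act AP Q) (x' : RState M A) :
    0 ≤ cV A x u x' := by
  unfold cV
  split
  · exact labelSetDist_nonneg _ _
  · rfl

theorem cV_le (x : RState M A) (u : RAction Act AP Q) (x' : RState M A) :
    cV A x u x' ≤ Fintype.card AP := by
  unfold cV
  split
  · exact labelSetDist_le _ _
  · positivity

/-- The automaton component of the successors under the action `u`. -/
def succNode (x : RState M A) (u : RAction Act AP Q) : Q × Finset (Fin f) :=
  (u.next, A.frontier u.next x.2.2)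

theorem Available.edge {x : RState M A} {u : RAction Act AP Q} (h : Available A x u) :
    A.Edge x.2 (succNode x u) := ⟨u.sym, h.2, rfl⟩

/-- Randomness affects only the MDP component: all successors under `u` share one pair of automaton
state and frontier. Potentials depending on that pair alone can therefore be compared without
averaging. -/
theorem eq_succNode_of_pR_ne_zero {x : RState M A} {u : RAction Act AP Q} {x' : RState M A}
    (h : pR A x u x' ≠ 0) : x'.2 = succNode x u := by
  unfold pR at h
  by_contra hne
  refine h (if_neg fun h' => hne (Prod.ext h'.2.1 ?_))
  exact h'.2.2

theorem Policy.exists_of_P_ne_zero {π : Policy M A} {x x' : RState M A} (h : π.P x x' ≠ 0) :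
    ∃ u, π.w x u ≠ 0 ∧ Available A x u ∧ x'.2 = succNode x u := by
  obtain ⟨u, -, hu⟩ := Finset.exists_ne_zero_of_sum_ne_zero h
  have hw := left_ne_zero_of_mul hu
  exact ⟨u, hw, π.supp x u hw, eq_succNode_of_pR_ne_zero (right_ne_zero_of_mul hu)⟩

theorem Policy.edge_of_P_ne_zero {π : Policy M A} {x x' : RState M A} (h : π.P x x' ≠ 0) :
    A.Edge x.2 x'.2 := by
  obtain ⟨u, -, hu, hx'⟩ := exists_of_P_ne_zero h
  exact hx' ▸ hu.edge

theorem gain_le {β γ c : ℝ} (hβ : 0 ≤ β) {v : RState M A → ℝ} {x : RState M A}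
    {u : RAction Act AP Q} (hu : Available A x u)
    (h : ∀ x', x'.2 = succNode x u → γ * v x' ≤ c) : gain β γ v x u ≤ c := by
  rw [← one_mul c, ← sum_pR x u hu, Finset.sum_mul]
  refine Finset.sum_le_sum fun x' _ => ?_
  by_cases hp : pR A x u x' = 0
  · simp [hp]
  · refine mul_le_mul_of_nonneg_left ?_ (pR_nonneg x u x')
    linarith [h x' (eq_succNode_of_pR_ne_zero hp), mul_nonneg hβ (cV_nonneg x u x')]

theorem le_gain {β γ c : ℝ} (hβ : 0 ≤ β) {v : RState M A → ℝ} {x : RState M A}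
    {u : RAction Act AP Q} (hu : Available A x u)
    (h : ∀ x', x'.2 = succNode x u → c ≤ γ * v x' - β * Fintype.card AP) :
    c ≤ gain β γ v x u := by
  rw [← one_mul c, ← sum_pR x u hu, Finset.sum_mul]
  refine Finset.sum_le_sum fun x' _ => ?_
  by_cases hp : pR A x u x' = 0
  · simp [hp]
  · refine mul_le_mul_of_nonneg_left ?_ (pR_nonneg x u x')
    linarith [h x' (eq_succNode_of_pR_ne_zero hp), mul_le_mul_of_nonneg_left (cV_le x u x') hβ]

theorem accReward_of_acc {r : ℝ} {x : RState M A} (h : A.Acc x.2) : accReward A r x = r :=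
  if_pos h

theorem accReward_of_not_acc {r : ℝ} {x : RState M A} (h : ¬ A.Acc x.2) : accReward A r x = 0 :=
  if_neg h

/-- Where no accepting cycle can be reached, the return is at most `r` per accepting state. -/
theorem Policy.discountedReturn_le_count (π : Policy M A) {r β γ : ℝ} (hr : 0 ≤ r) (hβ : 0 ≤ β)
    (h0 : 0 ≤ γ) (h1 : γ < 1) {x : RState M A} (hx : ¬ A.Good x.2) :
    π.discountedReturn r β γ x ≤ r * A.count x.2 := by
  refine discountedReturn_le (s := {x | ¬ A.Good x.2}) (W := fun x => r * A.count x.2) h0 h1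
    (fun y hy z hz hg => hy (hg.of_edge (edge_of_P_ne_zero hz))) (fun y hy => ?_) x hx
  have h : ∑ u, π.w y u * gain β γ (fun x => r * A.count x.2) y u ≤
      r * A.count y.2 - accReward A r y := by
    have hc : 0 ≤ r * A.count y.2 - accReward A r y := by
      by_cases ha : A.Acc y.2
      · have : 1 ≤ A.count y.2 :=
          (Set.ncard_pos (Set.toFinite _)).2 ⟨y.2, ha, .refl⟩
        have h' : (1 : ℝ) ≤ A.count y.2 := by exact_mod_cast this
        rw [accReward_of_acc ha]
        nlinarith
      · rw [accReward_of_not_acc ha, sub_zero]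
        positivity
    have hsum : ∑ u, π.w y u ≤ 1 := by
      by_cases hy : ∃ u, Available A y u
      · exact (π.sum_one y hy).le
      · simp [π.w_eq_zero_of_not_available hy]
    calc _ ≤ ∑ u, π.w y u * (r * A.count y.2 - accReward A r y) := by
          refine Finset.sum_le_sum fun u _ => ?_
          by_cases hu : π.w y u = 0
          · simp [hu]
          refine mul_le_mul_of_nonneg_left ?_ (π.nonneg y u)
          have hav := π.supp y u hu
          refine gain_le hβ hav fun z hz => ?_
          have hle : γ * (r * A.count z.2) ≤ r * A.count z.2 :=
            mul_le_of_le_one_left (by positivity) h1.le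
          refine hle.trans ?_
          rw [hz]
          -- At an accepting state the drop of the count pays for the reward; elsewhere the count
          -- need only be nonincreasing.
          by_cases ha : A.Acc y.2
          · have : (A.count (succNode y u) : ℝ) + 1 ≤ A.count y.2 := by
              exact_mod_cast LDGBA.count_lt_of_edge hav.edge ha hy
            rw [accReward_of_acc ha]
            nlinarith
          · have : (A.count (succNode y u) : ℝ) ≤ A.count y.2 := by
              exact_mod_cast LDGBA.count_le_of_edge hav.edge
            rw [accReward_of_not_acc ha]
            nlinarith
      _ = (∑ u, π.w y u) * (r * A.count y.2 - accReward A r y) := by rw [Finset.sum_mul]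
      _ ≤ _ := mul_le_of_le_one_left hc hsum
  linarith

variable (M A) in
/-- A selection that moves along shortest paths to accepting states on cycles. -/
theorem exists_selection_rank : ∃ g : Selection M A, ∀ x : RState M A, A.Good x.2 →
    Available A x (g.1 x) ∧ A.Good (succNode x (g.1 x)) ∧
      (A.Acc x.2 ∨ A.rank (succNode x (g.1 x)) + 1 ≤ A.rank x.2) := by
  obtain ⟨g, hg⟩ := exists_selection (M := M) (A := A)
    (p := fun x u => Available A x u ∧ A.Good (succNode x u) ∧
      (A.Acc x.2 ∨ A.rank (succNode x u) + 1 ≤ A.rank x.2)) fun _ _ h => h.1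
  refine ⟨g, fun x hx => hg x ?_⟩
  obtain ⟨⟨q', T'⟩, ⟨ι, hι, hT⟩, h2, h3⟩ := hx.exists_edge
  dsimp only at hι hT
  subst hT
  obtain ⟨a, ha⟩ := M.avail_nonempty x.1.1.1
  exact ⟨⟨a, ι, q'⟩, ⟨ha, hι⟩, h2, h3⟩

/-- The potential `B - η * rank` is a subsolution on the good states. Away from accepting states the
drop of the rank covers the losses from discounting and violation; at accepting states the reward
covers the losses and the new rank. -/
theorem le_discountedReturn_of_rank {g : Selection M A}
    (hg : ∀ x : RState M A, A.Good x.2 →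
      Available A x (g.1 x) ∧ A.Good (succNode x (g.1 x)) ∧
        (A.Acc x.2 ∨ A.rank (succNode x (g.1 x)) + 1 ≤ A.rank x.2))
    {N r β γ B η : ℝ} (hN : 1 ≤ N) (hd : ∀ y, A.rank y ≤ N) (hr : 0 ≤ r) (hβ : 0 ≤ β)
    (hβr : β * Fintype.card AP * (8 * N) ≤ r) (h0 : 1 / 2 ≤ γ) (h1 : γ < 1)
    (hη : η * (2 * N) = r) (hB : (1 - γ) * B * (8 * N) = r)
    {x : RState M A} (hx : A.Good x.2) :
    B - r / 2 ≤ g.policy.discountedReturn r β γ x := by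
  have hη0 : 0 ≤ η := by
    by_contra! h
    nlinarith
  have key : ∀ y, η * A.rank y ≤ r / 2 := fun y => by
    nlinarith [mul_le_mul_of_nonneg_left (hd y) hη0]
  -- Both losses are at most `r / (8 * N) = η / 4`.
  have hc : (1 - γ) * B + β * Fintype.card AP ≤ η / 2 := by
    refine le_of_mul_le_mul_right ?_ (by positivity : 0 < 8 * N)
    linarith
  have hηr : η ≤ r / 2 := by nlinarith
  refine le_trans ?_ (Policy.le_discountedReturn (s := {x | A.Good x.2})
    (W := fun x => B - η * A.rank x.2) (by linarith) h1 (fun y hy z hz => ?_)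
    (fun y hy => ?_) x hx)
  · linarith [key x.2]
  · obtain ⟨u, hu, -, hz⟩ := Policy.exists_of_P_ne_zero hz
    have : u = g.1 y := by
      by_contra hne
      exact hu (by simp [Selection.policy, hne])
    subst this
    rw [Set.mem_ofPred_eq, hz]
    exact (hg y hy).2.1
  · obtain ⟨hav, -, h3⟩ := hg y hy
    rw [g.sum_w_mul_of_available ⟨_, hav⟩]
    by_cases ha : A.Acc y.2
    · rw [accReward_of_acc ha, ← sub_le_iff_le_add']
      refine le_gain hβ hav fun z hz => ?_
      rw [hz]
      have h5 := key (succNode y (g.1 y))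
      have h6 : 0 ≤ η * A.rank y.2 := by positivity
      have h7 : 0 ≤ η * A.rank (succNode y (g.1 y)) := by positivity
      have h8 : γ * (η * A.rank (succNode y (g.1 y))) ≤ r / 2 :=
        (mul_le_of_le_one_left h7 h1.le).trans h5
      linarith
    · rw [accReward_of_not_acc ha, zero_add]
      refine le_gain hβ hav fun z hz => ?_
      rw [hz]
      have h5 : (A.rank (succNode y (g.1 y)) : ℝ) + 1 ≤ A.rank y.2 := by
        exact_mod_cast h3.resolve_left ha
      have h6 : 0 ≤ η * A.rank y.2 := by positivity
      have h7 : η * A.rank (succNode y (g.1 y)) + η ≤ η * A.rank y.2 := by nlinarith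
      -- As `1 / 2 ≤ γ`, the decrease of the rank is worth at least `γ * η ≥ η / 2`, which covers
      -- the losses in `hc`.
      nlinarith

/-- Since `C` contains the deterministic policies, an optimal return coincides with that of the
unimprovable deterministic policy. -/
theorem IsOptimal.bellman {C : Set (Policy M A)} {r β γ : ℝ} (h0 : 0 ≤ γ) (h1 : γ < 1)
    (hC : {π | π.IsDeterministic} ⊆ C) {π : Policy M A} (hπ : IsOptimal C r β γ π)
    {x : RState M A} {u : RAction Act AP Q} (hu : Available A x u) :
    accReward A r x + gain β γ (π.discountedReturn r β γ) x u ≤ π.discountedReturn r β γ x := by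
  obtain ⟨g, hg⟩ := exists_selection_bellman (M := M) (A := A) r β h0 h1
  have h : π.discountedReturn r β γ = g.policy.discountedReturn r β γ := by
    refine funext fun y => le_antisymm (π.discountedReturn_le_of_bellman h0 h1 ?_ hg y)
      (hπ.2 _ (hC g.isDeterministic) y)
    intro y hy
    rw [g.policy.discountedReturn_eq h0 h1]
    simp [Policy.w_eq_zero_of_not_available _ hy]
  rw [h]
  exact hg x u hu

theorem exists_isOptimal {C : Set (Policy M A)} (r β : ℝ) {γ : ℝ} (h0 : 0 ≤ γ) (h1 : γ < 1)
    (hC : {π | π.IsDeterministic} ⊆ C) : ∃ π, IsOptimal C r β γ π := by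
  obtain ⟨g, hg⟩ := exists_selection_bellman (M := M) (A := A) r β h0 h1
  refine ⟨g.policy, hC g.isDeterministic, fun π _ =>
    π.discountedReturn_le_of_bellman h0 h1 (fun y hy => ?_) hg⟩
  rw [g.policy.discountedReturn_eq h0 h1]
  simp [Policy.w_eq_zero_of_not_available _ hy]

/-- The return is an average of one-step values none of which exceeds it, so each value carrying
positive weight equals it. This covers randomized optimal policies. -/
theorem IsOptimal.eq_of_w_ne_zero {C : Set (Policy M A)} {r β γ : ℝ} (h0 : 0 ≤ γ) (h1 : γ < 1)
    (hC : {π | π.IsDeterministic} ⊆ C) {π : Policy M A} (hπ : IsOptimal C r β γ π)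
    {x : RState M A} {u : RAction Act AP Q} (hu : π.w x u ≠ 0) :
    π.discountedReturn r β γ x =
      accReward A r x + gain β γ (π.discountedReturn r β γ) x u := by
  refine le_antisymm ?_ (hπ.bellman h0 h1 hC (π.supp x u hu))
  by_contra! hlt
  have h := π.discountedReturn_eq (r := r) (β := β) h0 h1 x
  have hsum : ∑ v, π.w x v * gain β γ (π.discountedReturn r β γ) x v <
      ∑ v, π.w x v * (π.discountedReturn r β γ x - accReward A r x) := by
    refine Finset.sum_lt_sum (fun v _ => ?_) ⟨u, Finset.mem_univ u, ?_⟩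
    · by_cases hv : π.w x v = 0
      · simp [hv]
      · exact mul_le_mul_of_nonneg_left
          (by linarith [hπ.bellman h0 h1 hC (π.supp x v hv)]) (π.nonneg x v)
    · exact mul_lt_mul_of_pos_left (by linarith) ((π.nonneg x u).lt_of_ne' hu)
  rw [← Finset.sum_mul, π.sum_one x ⟨u, π.supp x u hu⟩] at hsum
  linarith

theorem count_le_card (y : Q × Finset (Fin f)) : A.count y ≤ Nat.card (Q × Finset (Fin f)) :=
  Set.ncard_le_card _

/-- For suitable parameters, every optimal policy has positive return where an accepting cycle can
be reached, and never leaves this set of states. -/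
theorem exists_bounds_optimal (M : LabeledMDP S Act AP) (A : LDGBA AP Q f) :
    ∃ κ : ℝ, 0 < κ ∧ ∃ γ₀ : ℝ, 0 < γ₀ ∧ γ₀ < 1 ∧
      ∀ r β γ : ℝ, 0 < r → 0 < β → β ≤ κ * r → γ₀ < γ → γ < 1 →
        ∀ C : Set (Policy M A), {π | π.IsDeterministic} ⊆ C →
          ∀ π, IsOptimal C r β γ π → π.Closed {x | A.Good x.2} ∧
            ∀ x : RState M A, A.Good x.2 → 0 < π.discountedReturn r β γ x := by
  obtain ⟨N, hN, hd⟩ : ∃ N : ℝ, 1 ≤ N ∧ ∀ y, (A.rank y : ℝ) ≤ N := by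
    refine ⟨1 + ∑ y, (A.rank y : ℝ), ?_, fun y => ?_⟩
    · have : (0 : ℝ) ≤ ∑ y, (A.rank y : ℝ) := by positivity
      linarith
    · have := Finset.single_le_sum (f := fun y => (A.rank y : ℝ))
        (fun _ _ => by positivity) (Finset.mem_univ y)
      linarith
  set K : ℝ := ((Nat.card (Q × Finset (Fin f)) : ℕ) : ℝ) with hK
  have hK0 : 0 ≤ K := by positivity
  set m : ℝ := ((Fintype.card AP : ℕ) : ℝ) with hm
  have hm0 : 0 ≤ m := by positivity
  have hD : 16 ≤ 8 * N * (K + 2) := by nlinarith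
  -- `κ` keeps the violation cost per step below `r / (8 * N)`; `γ₀` makes `B = r / ((1 - γ) * (8 *
  -- N))` exceed `(K + 2) * r`, so that `B - r / 2` beats `(K + 1) * r`, the most that a step into a
  -- bad state can yield.
  refine ⟨1 / (8 * N * (m + 1)), by positivity, 1 - 1 / (8 * N * (K + 2)), ?_, ?_, ?_⟩
  · rw [sub_pos, div_lt_one (by positivity)]
    linarith
  · have : 0 < 1 / (8 * N * (K + 2)) := by positivity
    linarith
  intro r β γ hr hβ hβr hγ h1 C hC π hπ
  have hinv : 1 / (8 * N * (K + 2)) ≤ 1 / 16 := one_div_le_one_div_of_le (by norm_num) hD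
  have hhalf : 1 / 2 ≤ γ := by linarith
  have h0 : 0 ≤ γ := by linarith
  have hβm : β * m * (8 * N) ≤ r := by
    rw [one_div_mul_eq_div, le_div_iff₀ (by positivity)] at hβr
    nlinarith [mul_pos hβ (by positivity : 0 < 8 * N)]
  have hγ1 : 0 < 1 - γ := by linarith
  have hB : (K + 2) * r < r / ((1 - γ) * (8 * N)) := by
    rw [lt_div_iff₀ (by positivity)]
    have h : (1 - γ) * (8 * N * (K + 2)) < 1 := by
      rw [← lt_div_iff₀ (by positivity)]
      linarith
    nlinarith
  obtain ⟨g, hg⟩ := exists_selection_rank M A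
  have hlow : ∀ x : RState M A, A.Good x.2 → (K + 1) * r < π.discountedReturn r β γ x := by
    intro x hx
    have h2 := le_discountedReturn_of_rank (η := r / (2 * N)) (B := r / ((1 - γ) * (8 * N)))
      hg hN hd hr.le hβ.le hβm hhalf h1 (by field_simp) (by field_simp) hx
    have h3 := hπ.2 _ (hC g.isDeterministic) x
    nlinarith
  refine ⟨fun x hx y hy => ?_, fun x hx => lt_of_le_of_lt (by positivity) (hlow x hx)⟩
  obtain ⟨u, hu, hav, hyu⟩ := Policy.exists_of_P_ne_zero hy
  by_contra hbad
  rw [Set.mem_ofPred_eq, hyu] at hbad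
  have h2 := hπ.eq_of_w_ne_zero h0 h1 hC hu
  have h3 : gain β γ (π.discountedReturn r β γ) x u ≤ r * K := by
    refine gain_le hβ.le hav fun z hz => ?_
    have h4 := π.discountedReturn_le_count hr.le hβ.le h0 h1 (x := z) (by rwa [hz])
    have h5 : r * A.count z.2 ≤ r * K :=
      mul_le_mul_of_nonneg_left (Nat.cast_le.2 (count_le_card z.2)) hr.le
    have h6 : 0 ≤ r * K := by positivity
    nlinarith
  have h4 : accReward A r x ≤ r := by
    unfold accReward
    split_ifs
    · rfl
    · exact hr.le
  linarith [hlow x hx]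

end Relaxed

end

/-! ### Almost sure recurrence of accepting states -/

noncomputable section

namespace Relaxed

variable {S Act AP Q : Type*} {f : ℕ} [Fintype S] [Fintype Act] [Fintype AP] [Fintype Q]
variable {M : LabeledMDP S Act AP} {A : LDGBA AP Q f}

-- The Markov property, stated for functions of the whole past so that it also applies to events
-- about a window of times.
open Preorder in
theorem Policy.lintegral_runLaw_succ (π : Policy M A) (n : ℕ)
    (F : (Π _ : Finset.Iic n, Config M A) × Config M A → ENNReal) :
    ∫⁻ ω, F (frestrictLe n ω, ω (n + 1)) ∂π.runLaw =
      ∫⁻ ω, ∑ c', ENNReal.ofReal (π.step (ω n) c') * F (frestrictLe n ω, c') ∂π.runLaw := by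
  have hF : Measurable F := measurable_of_countable F
  have h := Kernel.map_frestrictLe_trajMeasure_compProd_eq_map_trajMeasure
    (X := fun _ => Config M A) (μ₀ := Measure.dirac (some (init M A))) (κ := π.kernel) (a := n)
  rw [← lintegral_map (μ := π.runLaw) (f := F)
    (g := fun ω => (frestrictLe (π := fun _ => Config M A) n ω, ω (n + 1))) hF (by fun_prop)]
  unfold Policy.runLaw
  rw [← h, Measure.lintegral_compProd hF, lintegral_map .of_discrete (by fun_prop)]
  refine lintegral_congr fun ω => ?_
  rw [lintegral_fintype]
  refine Finset.sum_congr rfl fun c' _ => ?_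
  rw [mul_comm]
  congr 1
  change (π.stepPMF (ω n)).toMeasure {c'} = _
  rw [PMF.toMeasure_apply_singleton _ _ (measurableSet_singleton _)]
  rfl

open Preorder in
theorem Policy.runLaw_zero (π : Policy M A) : ∀ᵐ ω ∂π.runLaw, ω 0 = some (init M A) := by
  have h1 : π.runLaw = Kernel.traj (X := fun _ => Config M A) π.kernel 0
      ((MeasurableEquiv.piUnique fun _ : Finset.Iic 0 => Config M A).symm
        (some (init M A))) := by
    unfold Policy.runLaw Kernel.trajMeasure
    rw [Measure.map_dirac' (by fun_prop), Measure.dirac_bind (Kernel.measurable _)]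
  have h2 := Kernel.traj_map_frestrictLe_apply (X := fun _ => Config M A) (κ := π.kernel) 0 0
      ((MeasurableEquiv.piUnique fun _ : Finset.Iic 0 => Config M A).symm
        (some (init M A)))
  rw [← h1, Kernel.partialTraj_self, Kernel.id_apply] at h2
  have h3 : ∀ᵐ y ∂(π.runLaw.map (frestrictLe (π := fun _ => Config M A) 0)),
      y ⟨0, by simp⟩ = some (init M A) := by
    rw [h2, ae_dirac_iff .of_discrete]
    rfl
  exact ae_of_ae_map (by fun_prop) h3

/-- The configuration is an accepting state. -/
def AccConfig (c : Config M A) : Prop := ∃ x, c = some x ∧ A.Acc x.2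

open scoped Classical in
/-- The probability of visiting no accepting state in the first `k` steps. -/
def Policy.avoid (π : Policy M A) : ℕ → Config M A → ℝ
  | 0, _ => 1
  | k + 1, c => if AccConfig c then 0 else ∑ c', π.step c c' * π.avoid k c'

theorem Policy.avoid_nonneg (π : Policy M A) (k : ℕ) (c : Config M A) : 0 ≤ π.avoid k c := by
  induction k generalizing c with
  | zero => exact zero_le_one
  | succ k ih =>
    rw [avoid]
    split_ifs
    · rfl
    · exact Finset.sum_nonneg fun c' _ => mul_nonneg (π.step_nonneg c c') (ih c')

theorem Policy.avoid_succ_le (π : Policy M A) (k : ℕ) (c : Config M A) :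
    π.avoid (k + 1) c ≤ π.avoid k c := by
  induction k generalizing c with
  | zero =>
    rw [avoid, avoid]
    split_ifs
    · exact zero_le_one
    · simp [avoid, π.sum_step]
  | succ k ih =>
    rw [avoid, avoid]
    split_ifs
    · rfl
    · exact Finset.sum_le_sum fun c' _ => mul_le_mul_of_nonneg_left (ih c') (π.step_nonneg c c')

theorem Policy.avoid_le_one (π : Policy M A) (k : ℕ) (c : Config M A) : π.avoid k c ≤ 1 :=
  antitone_nat_of_succ_le (f := fun k => π.avoid k c) (fun k => π.avoid_succ_le k c) k.zero_le

theorem Policy.sum_P_of_available (π : Policy M A) {x : RState M A}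
    (hx : ∃ u, Available A x u) : ∑ x', π.P x x' = 1 := by
  have h := π.sum_P_mul (fun _ => 1) x
  simp only [mul_one] at h
  rw [h, ← π.sum_one x hx]
  refine Finset.sum_congr rfl fun u _ => ?_
  by_cases hu : π.w x u = 0
  · simp [hu]
  · rw [sum_pR x u (π.supp x u hu), mul_one]

variable (M) in
theorem exists_available_of_good {x : RState M A} (hx : A.Good x.2) : ∃ u, Available A x u := by
  obtain ⟨g, hg⟩ := exists_selection_rank M A
  exact ⟨_, (hg x hx).1⟩

theorem Policy.sum_step_of_good (π : Policy M A) {x : RState M A} (hx : A.Good x.2)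
    (h : Config M A → ℝ) : ∑ c, π.step (some x) c * h c = ∑ x', π.P x x' * h (some x') := by
  refine (Fintype.sum_option fun c => π.step (some x) c * h c).trans ?_
  simp [Policy.step, π.sum_P_of_available (exists_available_of_good M hx)]

/-- If the chain stays among the states that can reach an accepting cycle, and the return is
positive there, then accepting states are visited almost surely. -/
theorem Policy.tendsto_avoid {π : Policy M A} (hcl : π.Closed {x | A.Good x.2}) {r β γ : ℝ}
    (hβ : 0 ≤ β) (h0 : 0 ≤ γ) (h1 : γ < 1)
    (hpos : ∀ x : RState M A, A.Good x.2 → 0 < π.discountedReturn r β γ x)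
    {x : RState M A} (hx : A.Good x.2) :
    Tendsto (fun k => π.avoid k (some x)) atTop (𝓝 0) := by
  classical
  have hlim : ∀ c, ∃ l, Tendsto (fun k => π.avoid k c) atTop (𝓝 l) := fun c =>
    ⟨_, tendsto_atTop_ciInf (antitone_nat_of_succ_le fun k => π.avoid_succ_le k c)
      ⟨0, by rintro _ ⟨k, rfl⟩; exact π.avoid_nonneg k c⟩⟩
  choose l hl using hlim
  have hl0 : ∀ c, 0 ≤ l c := fun c => ge_of_tendsto' (hl c) fun k => π.avoid_nonneg k c
  have hrec : ∀ y : RState M A, A.Good y.2 →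
      l (some y) = if A.Acc y.2 then 0 else ∑ z, π.P y z * l (some z) := by
    intro y hy
    refine tendsto_nhds_unique ((tendsto_add_atTop_iff_nat 1).2 (hl (some y))) ?_
    by_cases ha : A.Acc y.2
    · have : AccConfig (some y : Config M A) := ⟨y, rfl, ha⟩
      simp [avoid, this, ha]
    · have : ¬ AccConfig (some y : Config M A) := by
        rintro ⟨z, hz, hz'⟩
        cases hz
        exact ha hz'
      simp only [avoid, this, if_false, ha]
      rw [← π.sum_step_of_good hy l]
      exact tendsto_finsetSum _ fun c _ => (hl c).const_mul _
  obtain ⟨m, hm, hmax⟩ := Set.exists_max_image {x : RState M A | A.Good x.2}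
    (fun y => l (some y)) (Set.toFinite _) ⟨x, hx⟩
  -- If the maximum `l (some m)` of the avoidance probability were positive, `hrec` would force the
  -- states attaining it to be non-accepting and to have all their successors among themselves. Such
  -- a closed set earns no reward, contradicting `hpos`.
  have hlm : l (some m) ≤ 0 := by
    by_contra! hlm
    have hna : ∀ y : RState M A, A.Good y.2 → l (some y) = l (some m) → ¬ A.Acc y.2 := by
      intro y hy hym ha
      have := hrec y hy
      rw [if_pos ha] at this
      linarith
    refine absurd (discountedReturn_le (π := π) (r := r) (β := β) (W := fun _ => 0) h0 h1
      (s := {y | A.Good y.2 ∧ l (some y) = l (some m)}) ?_ ?_ m ⟨hm, rfl⟩) (not_le.2 (hpos m hm))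
    · rintro y ⟨hy, hym⟩ z hz
      refine ⟨hcl y hy z hz, le_antisymm (hmax z (hcl y hy z hz)) ?_⟩
      by_contra! hlt
      have h2 := hrec y hy
      rw [if_neg (hna y hy hym), hym] at h2
      have h3 : ∑ z, π.P y z * l (some z) < ∑ z, π.P y z * l (some m) := by
        refine Finset.sum_lt_sum (fun w _ => ?_) ⟨z, Finset.mem_univ z,
          mul_lt_mul_of_pos_left hlt ((π.P_nonneg y z).lt_of_ne' hz)⟩
        by_cases hw : π.P y w = 0
        · simp [hw]
        · exact mul_le_mul_of_nonneg_left (hmax w (hcl y hy w hw)) (π.P_nonneg y w)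
      rw [← Finset.sum_mul, π.sum_P_of_available (exists_available_of_good M hy)] at h3
      linarith
    · rintro y ⟨hy, hym⟩
      rw [accReward_of_not_acc (hna y hy hym), zero_add]
      refine Finset.sum_nonpos fun u _ => ?_
      by_cases hu : π.w y u = 0
      · simp [hu]
      · exact mul_nonpos_of_nonneg_of_nonpos (π.nonneg y u)
          (gain_le hβ (π.supp y u hu) fun z _ => by simp)
  have : l (some x) = 0 := le_antisymm ((hmax x hx).trans hlm) (hl0 _)
  exact this ▸ hl (some x)

theorem Policy.step_runLaw (π : Policy M A) :
    ∀ᵐ ω ∂π.runLaw, ∀ n, π.step (ω n) (ω (n + 1)) ≠ 0 := by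
  classical
  refine ae_all_iff.2 fun n => ?_
  let G : Config M A → Config M A → ENNReal := fun c c' => if π.step c c' = 0 then 1 else 0
  have h : ∫⁻ ω, G (ω n) (ω (n + 1)) ∂π.runLaw =
      ∫⁻ ω, ∑ c', ENNReal.ofReal (π.step (ω n) c') * G (ω n) c' ∂π.runLaw :=
    π.lintegral_runLaw_succ n fun p => G (p.1 ⟨n, Finset.mem_Iic.2 le_rfl⟩) p.2
  have h2 : ∀ c, ∑ c', ENNReal.ofReal (π.step c c') * G c c' = 0 := fun c =>
    Finset.sum_eq_zero fun c' _ => by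
      by_cases hc : π.step c c' = 0 <;> simp [G, hc]
  simp only [h2, lintegral_zero] at h
  have hm : Measurable fun ω : ℕ → Config M A => G (ω n) (ω (n + 1)) :=
    (measurable_of_countable fun p : Config M A × Config M A => G p.1 p.2).comp
      (f := fun ω : ℕ → Config M A => (ω n, ω (n + 1))) (by fun_prop)
  filter_upwards [(lintegral_eq_zero_iff hm).1 h] with ω hω h3
  simp [G, h3] at hω

/-- A good state always has an available action, so a run staying among good states never ends. -/
theorem Policy.good_runLaw {π : Policy M A} (hcl : π.Closed {x | A.Good x.2})
    (hinit : A.Good (init M A).2) :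
    ∀ᵐ ω ∂π.runLaw, ∀ n, ∃ x, ω n = some x ∧ A.Good x.2 := by
  filter_upwards [π.runLaw_zero, π.step_runLaw] with ω h0 hstep n
  induction n with
  | zero => exact ⟨_, h0, hinit⟩
  | succ n ih =>
    obtain ⟨x, hx, hg⟩ := ih
    have h := hstep n
    rw [hx] at h
    cases hc : ω (n + 1) with
    | none =>
      rw [hc] at h
      exact absurd (by simp [Policy.step, π.sum_P_of_available (exists_available_of_good M hg)]) h
    | some y =>
      rw [hc] at h
      exact ⟨y, rfl, hcl x hg y h⟩

open scoped Classical in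
theorem Policy.lintegral_avoid_succ (π : Policy M A) (n k j : ℕ) :
    ∫⁻ ω, (if ∀ i, n ≤ i → i < n + k → ¬ AccConfig (ω i) then
      ENNReal.ofReal (π.avoid (j + 1) (ω (n + k))) else 0) ∂π.runLaw =
    ∫⁻ ω, (if ∀ i, n ≤ i → i < n + (k + 1) → ¬ AccConfig (ω i) then
      ENNReal.ofReal (π.avoid j (ω (n + (k + 1)))) else 0) ∂π.runLaw := by
  have h := π.lintegral_runLaw_succ (n + k) fun p =>
    if ∀ i : Finset.Iic (n + k), n ≤ i.1 → ¬ AccConfig (p.1 i) then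
      ENNReal.ofReal (π.avoid j p.2) else 0
  have h2 : ∀ ω : ℕ → Config M A, (∀ i : Finset.Iic (n + k), n ≤ i.1 → ¬ AccConfig (ω i)) ↔
      ∀ i, n ≤ i → i < n + (k + 1) → ¬ AccConfig (ω i) := fun ω =>
    ⟨fun h i h1 h2 => h ⟨i, Finset.mem_Iic.2 (by omega)⟩ h1,
      fun h i h1 => h i h1 (by have := Finset.mem_Iic.1 i.2; omega)⟩
  simp only [Preorder.frestrictLe_apply, h2] at h
  refine Eq.trans ?_ h.symm
  refine lintegral_congr fun ω => ?_
  by_cases hb : ∀ i, n ≤ i → i < n + k → ¬ AccConfig (ω i)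
  · by_cases ha : AccConfig (ω (n + k))
    · have hb' : ¬ ∀ i, n ≤ i → i < n + (k + 1) → ¬ AccConfig (ω i) := fun h =>
        h (n + k) (by omega) (by omega) ha
      simp [avoid, ha, hb']
    · have hb' : ∀ i, n ≤ i → i < n + (k + 1) → ¬ AccConfig (ω i) := fun i h1 h2 => by
        rcases (by omega : i < n + k ∨ i = n + k) with h3 | rfl
        · exact hb i h1 h3
        · exact ha
      simp only [if_pos hb, if_pos hb', avoid, if_neg ha]
      rw [ENNReal.ofReal_sum_of_nonneg fun c _ =>
        mul_nonneg (π.step_nonneg _ c) (π.avoid_nonneg j c)]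
      exact Finset.sum_congr rfl fun c _ => ENNReal.ofReal_mul (π.step_nonneg _ c)
  · have hb' : ¬ ∀ i, n ≤ i → i < n + (k + 1) → ¬ AccConfig (ω i) := fun h =>
      hb fun i h1 h2 => h i h1 (by omega)
    simp [hb, hb']

/-- Conditioning at time `n` and unrolling `avoid` with the Markov property `k` times gives the
probability of avoidance on the window from `n` to `n + k - 1`, which dominates that of avoidance
forever. -/
theorem Policy.measure_avoid_le (π : Policy M A) (n k : ℕ) :
    π.runLaw {ω | ∀ i, n ≤ i → ¬ AccConfig (ω i)} ≤
      ∫⁻ ω, ENNReal.ofReal (π.avoid k (ω n)) ∂π.runLaw := by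
  classical
  have h : ∀ m j, ∫⁻ ω, (if ∀ i, n ≤ i → i < n + j → ¬ AccConfig (ω i) then
      ENNReal.ofReal (π.avoid m (ω (n + j))) else 0) ∂π.runLaw =
      ∫⁻ ω, ENNReal.ofReal (π.avoid (m + j) (ω n)) ∂π.runLaw := by
    intro m j
    induction j generalizing m with
    | zero =>
      refine lintegral_congr fun ω => ?_
      rw [if_pos fun i h1 h2 => by omega]
      rfl
    | succ j ih =>
      rw [← π.lintegral_avoid_succ, ih, add_right_comm, add_assoc]
  have hms : MeasurableSet {ω : ℕ → Config M A | ∀ i, n ≤ i → ¬ AccConfig (ω i)} := by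
    have : {ω : ℕ → Config M A | ∀ i, n ≤ i → ¬ AccConfig (ω i)} =
        ⋂ i, ⋂ _ : n ≤ i, (fun ω => ω i) ⁻¹' {c | ¬ AccConfig c} := by
      ext ω
      simp
    rw [this]
    exact .iInter fun i => .iInter fun _ => measurable_pi_apply i (.of_discrete)
  rw [← lintegral_indicator_one hms, ← zero_add k, ← h 0 k]
  refine lintegral_mono fun ω => ?_
  by_cases hω : ∀ i, n ≤ i → ¬ AccConfig (ω i)
  · rw [if_pos fun i h1 _ => hω i h1]
    simp [avoid, Set.indicator_of_mem (show ω ∈ {ω | ∀ i, n ≤ i → ¬ AccConfig (ω i)} from hω)]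
  · rw [Set.indicator_of_notMem (by exact hω)]
    exact zero_le

/-- The law of `ω n` is carried by good states, where `avoid k` tends to zero; by dominated
convergence no accepting visit after time `n` has probability zero, for every `n`. -/
theorem Policy.frequently_accConfig {π : Policy M A} (hcl : π.Closed {x | A.Good x.2})
    (hinit : A.Good (init M A).2) {r β γ : ℝ} (hβ : 0 ≤ β) (h0 : 0 ≤ γ) (h1 : γ < 1)
    (hpos : ∀ x : RState M A, A.Good x.2 → 0 < π.discountedReturn r β γ x) :
    ∀ᵐ ω ∂π.runLaw, ∃ᶠ n in atTop, AccConfig (ω n) := by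
  have h : ∀ n, ∀ᵐ ω ∂π.runLaw, ∃ i, n ≤ i ∧ AccConfig (ω i) := by
    intro n
    have hp : IsProbabilityMeasure π.runLaw := by
      unfold runLaw
      infer_instance
    have hlim : Tendsto (fun k => ∫⁻ ω, ENNReal.ofReal (π.avoid k (ω n)) ∂π.runLaw) atTop
        (𝓝 (∫⁻ _, 0 ∂π.runLaw)) := by
      refine tendsto_lintegral_of_dominated_convergence (fun _ => 1) (fun k => ?_)
        (fun k => ae_of_all _ fun ω => ?_) (by simp) ?_
      · exact (measurable_of_countable fun c => ENNReal.ofReal (π.avoid k c)).comp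
          (measurable_pi_apply n)
      · exact ENNReal.ofReal_le_one.2 (π.avoid_le_one k _)
      · filter_upwards [good_runLaw hcl hinit] with ω hω
        obtain ⟨x, hx, hg⟩ := hω n
        rw [hx, ← ENNReal.ofReal_zero]
        exact ENNReal.tendsto_ofReal (tendsto_avoid hcl hβ h0 h1 hpos hg)
    rw [lintegral_zero] at hlim
    have hz := le_antisymm (ge_of_tendsto' hlim fun k => π.measure_avoid_le n k) zero_le
    filter_upwards [measure_eq_zero_iff_ae_notMem.1 hz] with ω hω
    by_contra! hcon
    exact hω hcon
  filter_upwards [ae_all_iff.2 h] with ω hω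
  exact frequently_atTop.2 hω

end Relaxed

end

/-! ### The tracking frontier -/

namespace LDGBA

variable {AP Q : Type*} {f : ℕ} {A : LDGBA AP Q f}

/-- On an infinite path that is accepting infinitely often, the frontier makes sure that every
accepting set is visited infinitely often. -/
theorem frequently_mem_of_frequently_acc {y : ℕ → Q × Finset (Fin f)}
    (hE : ∀ n, A.Edge (y n) (y (n + 1))) (hacc : ∃ᶠ n in atTop, A.Acc (y n)) (i : Fin f) :
    ∃ᶠ n in atTop, (y n).1 ∈ A.F i := by
  classical
  by_contra hcon
  obtain ⟨N, hN⟩ := eventually_atTop.1 (not_frequently.1 hcon)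
  -- A potential that decreases strictly at accepting visits once `F i` is no longer visited.
  -- Ordinary visits shrink the frontier without affecting membership of `i`; a reset turns the
  -- value `f + 1` of the empty frontier into at most `f`, since `i` is then back in it.
  let φ : ℕ → ℕ := fun n => (y n).2.card + if i ∈ (y n).2 then 0 else f + 1
  have hstep : ∀ n, N ≤ n → φ (n + 1) ≤ φ n ∧ (A.Acc (y (n + 1)) → φ (n + 1) < φ n) := by
    intro n hn
    have hi : i ∉ A.hits (y (n + 1)).1 := by
      simpa [hits] using hN (n + 1) (by omega)
    obtain ⟨ι, ⟨-, hadm⟩, hT⟩ := hE n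
    simp only [φ, hT, frontier]
    by_cases h1 : (A.hits (y (n + 1)).1 ∩ (y n).2).Nonempty
    · rw [if_pos h1]
      have hlt : ((y n).2 \ A.hits (y (n + 1)).1).card < (y n).2.card := by
        obtain ⟨j, hj⟩ := h1
        rw [Finset.mem_inter] at hj
        exact Finset.card_lt_card (Finset.ssubset_iff_subset_ne.2 ⟨Finset.sdiff_subset,
          fun h => (Finset.mem_sdiff.1 (h ▸ hj.2)).2 hj.1⟩)
      have hmem : i ∈ (y n).2 \ A.hits (y (n + 1)).1 ↔ i ∈ (y n).2 := by simp [hi]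
      simp only [hmem]
      exact ⟨by omega, fun _ => by omega⟩
    · rw [if_neg h1]
      by_cases h2 : (A.hits (y (n + 1)).1).Nonempty ∧ (y n).2 = ∅
      · rw [if_pos h2, if_pos (by simp [hi]), h2.2]
        have hle : (Finset.univ \ A.hits (y (n + 1)).1).card ≤ f :=
          (Finset.card_le_univ _).trans (by simp)
        simp only [Finset.card_empty, Finset.notMem_empty, if_false]
        exact ⟨by omega, fun _ => by omega⟩
      · rw [if_neg h2]
        refine ⟨le_rfl, fun ⟨j, hj⟩ => ?_⟩
        have hjh : j ∈ A.hits (y (n + 1)).1 := by simpa [hits] using hj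
        -- The frontier can stay unchanged only at a non-accepting state: admissibility rules out
        -- accepting states that neither hit the frontier nor reset it.
        rcases hadm with h3 | ⟨k, hk, hk'⟩ | h3
        · exact absurd hj (h3 j)
        · exact absurd ⟨k, Finset.mem_inter.2 ⟨by simpa [hits] using hk', hk⟩⟩ h1
        · exact absurd ⟨⟨j, hjh⟩, h3⟩ h2
  obtain ⟨n₀, hn₀, hmin⟩ : ∃ n₀, N ≤ n₀ ∧ ∀ n, N ≤ n → φ n₀ ≤ φ n := by
    obtain ⟨n₀, h, h'⟩ := exists_minimalFor_of_wellFoundedLT (fun n => N ≤ n) φ ⟨N, le_rfl⟩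
    exact ⟨n₀, h, fun n hn => (le_total (φ n₀) (φ n)).elim id fun h2 => h' hn h2⟩
  have hanti : ∀ k, φ (n₀ + k) ≤ φ n₀ := fun k => by
    induction k with
    | zero => rfl
    | succ k ih => exact (hstep (n₀ + k) (by omega)).1.trans ih
  obtain ⟨n, hn, ha⟩ := frequently_atTop.1 hacc (n₀ + 1)
  obtain ⟨k, rfl⟩ : ∃ k, n = n₀ + k + 1 := ⟨n - n₀ - 1, by omega⟩
  have := (hstep (n₀ + k) (by omega)).2 ha
  have := hanti k
  have := hmin (n₀ + k + 1) (by omega)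
  omega

end LDGBA

/-! ### Accepted runs and conclusion -/

namespace Relaxed

variable {S Act AP Q : Type*} {f : ℕ} [Fintype S] [Fintype Act] [Fintype AP] [Fintype Q]
variable {M : LabeledMDP S Act AP} {A : LDGBA AP Q f}

/-- By finiteness of the state space, infinitely many visits to `F i` contain infinitely many visits
to a single state. -/
theorem accepted_of_frequently_acc {ρ : ℕ → RState M A}
    (hE : ∀ n, A.Edge (ρ n).2 (ρ (n + 1)).2) (hacc : ∃ᶠ n in atTop, A.Acc (ρ n).2) :
    Accepted fun n => some (ρ n) := by
  intro i
  have h := LDGBA.frequently_mem_of_frequently_acc (y := fun n => (ρ n).2) hE hacc i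
  have h2 : ∃ᶠ n in atTop, ∃ x : RState M A, x ∈ accSet A i ∧ some (ρ n) = some x :=
    h.mono fun n hn => ⟨ρ n, hn, rfl⟩
  obtain ⟨x, hx⟩ := Filter.frequently_exists.1 h2
  exact ⟨x, hx.exists.choose_spec.1, hx.mono fun n hn => hn.2⟩

/-- Here `0 < f` is needed: the run returns to some state of `F 0`, whose automaton pair is then
accepting and on a cycle. Since only edges of the pair graph are used, the dependence of the policy
on the past plays no role. -/
theorem good_init {ξ : ControlPolicy M A} {ρ : ℕ → RState M A} (hf : 0 < f)
    (hρ : IsInducedRun ξ ρ) (hacc : Accepted fun n => some (ρ n)) : A.Good (init M A).2 := by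
  have hE : ∀ n, A.Edge (ρ n).2 (ρ (n + 1)).2 := fun n =>
    Policy.edge_of_P_ne_zero (hρ.2 n).ne'
  have hpath : ∀ n k, Relation.ReflTransGen A.Edge (ρ n).2 (ρ (n + k)).2 := fun n k => by
    induction k with
    | zero => exact .refl
    | succ k ih => exact ih.tail (hE _)
  obtain ⟨x, hx, hfreq⟩ := hacc ⟨0, hf⟩
  obtain ⟨n, -, hn⟩ := frequently_atTop.1 hfreq 0
  obtain ⟨m, hm, hm'⟩ := frequently_atTop.1 hfreq (n + 1)
  obtain ⟨k, rfl⟩ := Nat.exists_eq_add_of_le hm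
  have hn := Option.some.inj hn
  have hm' := Option.some.inj hm'
  have h0 := hpath 0 n
  rw [hρ.1, zero_add, hn] at h0
  refine LDGBA.Good.of_reflTransGen h0 ⟨0, ⟨_, hx⟩, Relation.TransGen.head' (hn ▸ hE n) ?_⟩
  have := hpath (n + 1) k
  rwa [hm'] at this

theorem Policy.satisfies_of_closed {π : Policy M A} (hcl : π.Closed {x | A.Good x.2})
    (hinit : A.Good (init M A).2) {r β γ : ℝ} (hβ : 0 ≤ β) (h0 : 0 ≤ γ) (h1 : γ < 1)
    (hpos : ∀ x : RState M A, A.Good x.2 → 0 < π.discountedReturn r β γ x) : π.Satisfies := by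
  filter_upwards [good_runLaw hcl hinit, π.step_runLaw,
    frequently_accConfig hcl hinit hβ h0 h1 hpos] with ω hgood hstep hfreq
  choose ρ hρ _ using hgood
  obtain rfl : ω = fun n => some (ρ n) := funext hρ
  refine accepted_of_frequently_acc (fun n => edge_of_P_ne_zero (hstep n))
    (hfreq.mono fun n hn => ?_)
  obtain ⟨x, hx, ha⟩ := hn
  cases hx
  exact ha

end Relaxed

theorem mainTheorem1 {S Act AP Q : Type*} [Fintype S] [Fintype Act] [Fintype AP] [Fintype Q]
    {f : ℕ} (hf : 0 < f) (M : LabeledMDP S Act AP) (A : LDGBA AP Q f)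
    (h : ∃ (ξ : Relaxed.ControlPolicy M A) (ρ : ℕ → RState M A),
      Relaxed.IsInducedRun ξ ρ ∧ Relaxed.Accepted (fun n => some (ρ n))) :
    ∃ κ : ℝ, 0 < κ ∧ ∃ γ₀ : ℝ, 0 < γ₀ ∧ γ₀ < 1 ∧
      ∀ r β γ : ℝ, 0 < r → 0 < β → β ≤ κ * r → γ₀ < γ → γ < 1 →
        ∀ C : Set (Relaxed.Policy M A), {π | π.IsDeterministic} ⊆ C →
          (∃ π, Relaxed.IsOptimal C r β γ π) ∧
          ∀ π, Relaxed.IsOptimal C r β γ π → π.Satisfies := by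
  obtain ⟨ξ, ρ, hρ, hacc⟩ := h
  have hinit := Relaxed.good_init hf hρ hacc
  obtain ⟨κ, hκ, γ₀, hγ₀, hγ₁, hopt⟩ := Relaxed.exists_bounds_optimal M A
  refine ⟨κ, hκ, γ₀, hγ₀, hγ₁, fun r β γ hr hβ hβr hγ h1 C hC => ?_⟩
  have h0 : 0 ≤ γ := (hγ₀.trans hγ).le
  refine ⟨Relaxed.exists_isOptimal r β h0 h1 hC, fun π hπ => ?_⟩
  obtain ⟨hcl, hpos⟩ := hopt r β γ hr hβ hβr hγ h1 C hC π hπ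
  exact Relaxed.Policy.satisfies_of_closed hcl hinit hβ.le h0 h1 hpos
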